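/- Let $(U_i)_{i\ge 0}$ be the integer sequence with $U_0=1$, $U_1=13$, $U_2=163$ and $U_{i+3}=12\,U_{i+2}+6\,U_{i+1}+12\,U_i$ for all $i\ge 0$. Let $\beta_1\in\mathbb{Z}_2$ be the root of $P(x)=x^3-12x^2-6x-12$ with $\beta_1\equiv 2\pmod 4$, and let $\beta_2,\beta_3$ be the other two roots of $P$ in an algebraic closure of $\mathbb{Q}_2$. Put \[ c_2=\frac{-U_0\beta_3\beta_1+U_1(\beta_3+\beta_1)-U_2}{(\beta_3-\beta_2)(\beta_2-\beta_1)},\qquad c_3=\frac{-U_0\beta_1\beta_2+U_1(\beta_1+\beta_2)-U_2}{(\beta_1-\beta_3)(\beta_3-\beta_2)}, \] (the coefficients of $\beta_2^i$ and $\beta_3^i$ in the expansion $U_i=c_1\beta_1^i+c_2\beta_2^i+c_3\beta_3^i$), let $\log_2(1+x)=\sum_{n\ge 1}(-1)^{n+1}x^n/n$ be the $2$-adic logarithm (for $|x|_2<1$), let $L=\log_2\bigl((\beta_3/\beta_2)^4\bigr)$, and let \[ \zeta = 1+4\,\frac{1}{L}\,\log_2\!\left(-\frac{c_2\beta_2}{c_3\beta_3}\right).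 \] Then $\zeta\in\mathbb{Z}_2$. Write $\zeta=\sum_{j\ge 0}d_j2^j$ with $d_j\in\{0,1\}$ and, for $a\ge 0$, let $\ell_\zeta(a)\ge 0$ be the largest integer $\ell$ such that $d_a=d_{a+1}=\dots=d_{a+\ell-1}=0$. Suppose that, for every $a\ge 0$, $\ell_\zeta(a)$ exists (that is, the block of zeros starting at position $a$ is finite) and $\ell_\zeta(a)\le\frac{2}{95}a+\frac{18}{5}$. Then, for all $i\ge 10$, \[ \nu_2(U_i)=\left\lfloor\frac{i-1}{2}\right\rfloor+ \begin{cases} \nu_2(i-\zeta) & \text{if } i\equiv 1\pmod 4,\\ 0 & \text{if } i\not\equiv 1\pmod 4, \end{cases} \] where $\nu_2$ is the $2$-adic valuation on $\mathbb{Q}_2$ (with $\nu_2(0)=\infty$). -/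

import Mathlib

open Polynomial

noncomputable section

/-- The sequence `U_{i+3} = 12 U_{i+2} + 6 U_{i+1} + 12 U_i` with `U_0 = 1`, `U_1 = 13`,
`U_2 = 163`. -/
def toyU : ℕ → ℕ
  | 0 => 1
  | 1 => 13
  | 2 => 163
  | i + 3 => 12 * toyU (i + 2) + 6 * toyU (i + 1) + 12 * toyU i

/-- The inclusion of `ℤ_p` into the algebraic closure of `ℚ_p`. -/
def padicIntToAlgCl (p : ℕ) [Fact p.Prime] : ℤ_[p] →+* PadicAlgCl p :=
  (algebraMap ℚ_[p] (PadicAlgCl p)).comp (PadicInt.Coe.ringHom (p := p))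

/-- The `p`-adic logarithm `log_p (1 + x) = ∑_{n ≥ 1} (-1)^(n+1) x^n / n`, on the algebraic
extension `PadicAlgCl p` of `ℚ_p`.  The series converges whenever `‖y - 1‖ < 1`: the partial sums
lie in the finite, hence complete, extension `ℚ_p(y)`. -/
def padicLog (p : ℕ) [Fact p.Prime] (y : PadicAlgCl p) : PadicAlgCl p :=
  ∑' n : ℕ, (-1) ^ n * (y - 1) ^ (n + 1) / ((n : PadicAlgCl p) + 1)

/-- The `i`-th digit `d_i ∈ {0, …, p - 1}` of the `p`-adic integer `x = ∑ d_i p^i`; here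
`x.appr n ∈ {0, …, p^n - 1}` is the residue of `x` modulo `p^n`. -/
def padicDigit {p : ℕ} [Fact p.Prime] (x : ℤ_[p]) (i : ℕ) : ℕ :=
  x.appr (i + 1) / p ^ i

/-- `ℓ` is the length `ℓ_x(a)` of the block of zero digits of `x` starting at position `a`: the
largest `ℓ` such that `0 = d_a = d_{a+1} = ⋯ = d_{a+ℓ-1}`. -/
def IsZeroBlockLength {p : ℕ} [Fact p.Prime] (x : ℤ_[p]) (a ℓ : ℕ) : Prop :=
  IsGreatest {k : ℕ | ∀ j < k, padicDigit x (a + j) = 0} ℓ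

/-- The bound `ℓ_ζ(a) ≤ (2/95) a + 18/5` for all `a ≥ 0` (in particular, every block of zeros of
`ζ` is finite). -/
def BlockLengthBound (ζ : ℤ_[2]) : Prop :=
  ∀ a : ℕ, ∃ ℓ : ℕ, IsZeroBlockLength ζ a ℓ ∧ (ℓ : ℝ) ≤ 2 / 95 * (a : ℝ) + 18 / 5

/-- `β₁, β₂, β₃` are the roots, with multiplicity, of the characteristic polynomial
`x³ - 12 x² - 6 x - 12` of `toyU`, where `β₁` is in `ℤ_2` and `β₁ ≡ 2 (mod 4)`. -/
structure IsToyRoots (β₁ : ℤ_[2]) (β₂ β₃ : PadicAlgCl 2) : Prop where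
  modFour : (4 : ℤ_[2]) ∣ β₁ - 2
  factor : (X ^ 3 - 12 * X ^ 2 - 6 * X - 12 : (PadicAlgCl 2)[X]) =
    (X - C (padicIntToAlgCl 2 β₁)) * (X - C β₂) * (X - C β₃)

/-- Such roots exist. -/
theorem exists_isToyRoots : ∃ β₁ β₂ β₃, IsToyRoots β₁ β₂ β₃ := by
  have hP : ‖(X ^ 3 - 12 * X ^ 2 - 6 * X - 12 : ℤ_[2][X]).aeval (2 : ℤ_[2])‖ =
      ‖((-64 : ℤ) : ℤ_[2])‖ := by
    congr 1; simp; norm_num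
  have hP' : ‖(derivative (X ^ 3 - 12 * X ^ 2 - 6 * X - 12 : ℤ_[2][X])).aeval (2 : ℤ_[2])‖ =
      ‖((-42 : ℤ) : ℤ_[2])‖ := by
    congr 1; simp; norm_num
  have h64 : ‖((-64 : ℤ) : ℤ_[2])‖ = (2 : ℝ)⁻¹ ^ 6 := by
    have : ((-64 : ℤ) : ℤ_[2]) = -((2 : ℕ) : ℤ_[2]) ^ 6 := by norm_num
    rw [this, norm_neg, norm_pow, PadicInt.norm_p]; norm_num
  have h42 : ‖((-42 : ℤ) : ℤ_[2])‖ = (2 : ℝ)⁻¹ := by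
    have : ((-42 : ℤ) : ℤ_[2]) = -(((2 : ℕ) : ℤ_[2]) * ((21 : ℤ) : ℤ_[2])) := by norm_num
    have h21 : ‖((21 : ℤ) : ℤ_[2])‖ = 1 := by
      refine le_antisymm (PadicInt.norm_le_one _) (not_lt.1 fun h => ?_)
      have := (PadicInt.norm_int_lt_one_iff_dvd (p := 2) 21).1 h
      omega
    rw [this, norm_neg, norm_mul, PadicInt.norm_p, h21]; norm_num
  obtain ⟨b, hb, hb', -, -⟩ := hensels_lemma (p := 2) (R := ℤ_[2])
    (F := (X ^ 3 - 12 * X ^ 2 - 6 * X - 12 : ℤ_[2][X])) (a := 2) (by rw [hP, hP', h64, h42]; norm_num)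
  rw [hP', h42] at hb'
  have hb2 : ‖b - 2‖ ≤ (2 : ℝ) ^ (-(2 : ℤ)) := by
    have := (PadicInt.norm_le_pow_iff_norm_lt_pow_add_one (p := 2) (b - 2) (-2)).2
      (by norm_num at hb' ⊢; exact hb')
    exact_mod_cast this
  have h4 : (4 : ℤ_[2]) ∣ b - 2 := by
    have := (PadicInt.norm_le_pow_iff_mem_span_pow (p := 2) (b - 2) 2).1 (by exact_mod_cast hb2)
    rw [Ideal.mem_span_singleton] at this
    norm_num at this
    exact this
  have hroot : b ^ 3 - 12 * b ^ 2 - 6 * b - 12 = 0 := by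
    simpa using hb
  set B := padicIntToAlgCl 2 b with hB
  have hBroot : B ^ 3 - 12 * B ^ 2 - 6 * B - 12 = 0 := by
    have h := congrArg (padicIntToAlgCl 2) hroot
    simp only [map_sub, map_mul, map_pow, map_zero, map_ofNat] at h
    exact h
  obtain ⟨β, hβ⟩ := IsAlgClosed.exists_root
    (X ^ 2 + C (B - 12) * X + C (B ^ 2 - 12 * B - 6) : (PadicAlgCl 2)[X])
    (by
      have : (X ^ 2 + C (B - 12) * X + C (B ^ 2 - 12 * B - 6) : (PadicAlgCl 2)[X]).degree = 2 := by
        compute_degree!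
      rw [this]; norm_num)
  have hβ' : β ^ 2 + (B - 12) * β + (B ^ 2 - 12 * B - 6) = 0 := by
    simpa [IsRoot] using hβ
  refine ⟨b, β, 12 - B - β, h4, ?_⟩
  rw [← hB]
  have e1 := congrArg (C (R := PadicAlgCl 2)) hBroot
  have e2 := congrArg (C (R := PadicAlgCl 2)) hβ'
  simp only [map_sub, map_add, map_mul, map_pow, map_zero, map_ofNat] at e1 e2 ⊢
  linear_combination e1 + (X - C B) * e2

/-- The coefficient `c₂` in `U_i = c₁ β₁^i + c₂ β₂^i + c₃ β₃^i`. -/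
def toyC₂ (β₁ β₂ β₃ : PadicAlgCl 2) : PadicAlgCl 2 :=
  (-(toyU 0 : PadicAlgCl 2) * β₃ * β₁ + toyU 1 * (β₃ + β₁) - toyU 2) /
    ((β₃ - β₂) * (β₂ - β₁))

/-- The coefficient `c₃` in `U_i = c₁ β₁^i + c₂ β₂^i + c₃ β₃^i`. -/
def toyC₃ (β₁ β₂ β₃ : PadicAlgCl 2) : PadicAlgCl 2 :=
  (-(toyU 0 : PadicAlgCl 2) * β₁ * β₂ + toyU 1 * (β₁ + β₂) - toyU 2) /
    ((β₁ - β₃) * (β₃ - β₂))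

/-- `1 + 4 · (1/L) · log₂(- c₂ β₂ / (c₃ β₃))` with `L = log₂((β₃/β₂)⁴)`. -/
def toyZeta (β₁ β₂ β₃ : PadicAlgCl 2) : PadicAlgCl 2 :=
  1 + 4 * (1 / padicLog 2 ((β₃ / β₂) ^ 4)) *
    padicLog 2 (-(toyC₂ β₁ β₂ β₃ * β₂ / (toyC₃ β₁ β₂ β₃ * β₃)))

end

open Filter Topology

/-! For `i = 4n + 1`, subtracting the first term of the Binet formula leaves `c₂β₂^i + c₃β₃^i =
-c₂β₂ · β₂^(4n) · (q^n A⁻¹ - 1)`, with `q = (β₃/β₂)^4` and `A = -c₂β₂/(c₃β₃)`. Both `q` and `A` are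
within distance less than `1/2` of `1`, where the logarithm preserves the distance to `1`, so `‖q^n
A⁻¹ - 1‖ = ‖log q‖ ‖n - z‖` with `z = log A / log q`. Since `ζ = 1 + 4z`, the remainder has norm
`(1/4)^n ‖i - ζ‖` (`exists_zeta`). That `z` lies in `ℚ_2` is Galois descent: an automorphism
exchanging `β₂` and `β₃` inverts both `q` and `A` (`exists_log_ratio`).

The term `c₁β₁^i` has norm `(1/16)^n`, so it is negligible once `‖i - ζ‖ > (1/4)^n`. Otherwise `ζ`
would agree with `i` modulo `2^(2n)`; if also `i < 2^n`, this produces `n` consecutive zero digits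
of `ζ` from position `n`, contrary to the block bound (`BlockLengthBound.lt_norm_sub`).

For `i` in the other classes modulo 4 the valuation follows from the recurrence by an elementary
induction (`exists_toyU_eq`). -/

theorem Padic.one_le_natCast_mul_norm {p : ℕ} [Fact p.Prime] {n : ℕ} (hn : n ≠ 0) :
    1 ≤ (n : ℝ) * ‖(n : ℚ_[p])‖ := by
  have hp : 0 < (p : ℝ) ^ padicValNat p n := by
    have := (Fact.out : p.Prime).pos
    positivity
  rw [Padic.norm_eq_zpow_neg_valuation (by exact_mod_cast hn), Padic.valuation_natCast,
    zpow_neg, zpow_natCast, ← div_eq_mul_inv, le_div_iff₀ hp, one_mul]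
  exact_mod_cast Nat.le_of_dvd (Nat.pos_of_ne_zero hn) pow_padicValNat_dvd

/-! ### The logarithm series as the limit of `((1 + x)^(p^n) - 1) / p^n`. -/

section LogLimit

variable {p : ℕ} [Fact p.Prime] {F : Type*} [NormedField F]
    [NormedAlgebra ℚ_[p] F]

theorem norm_natCast_eq_padicNorm (p : ℕ) [Fact p.Prime] (F : Type*) [NormedField F]
    [NormedAlgebra ℚ_[p] F] (n : ℕ) : ‖(n : F)‖ = ‖(n : ℚ_[p])‖ := by
  rw [← norm_algebraMap' F (n : ℚ_[p]), map_natCast]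

theorem norm_natCast_le_one_of_padic (p : ℕ) [Fact p.Prime] {F : Type*} [NormedField F]
    [NormedAlgebra ℚ_[p] F]
    (n : ℕ) : ‖(n : F)‖ ≤ 1 := by
  rw [norm_natCast_eq_padicNorm p]
  exact_mod_cast Padic.norm_int_le_one (p := p) n

theorem inv_norm_natCast_le (p : ℕ) [Fact p.Prime] {F : Type*} [NormedField F]
    [NormedAlgebra ℚ_[p] F]
    (n : ℕ) (hn : n ≠ 0) : ‖(n : F)‖⁻¹ ≤ n := by
  have h := Padic.one_le_natCast_mul_norm (p := p) hn
  rw [norm_natCast_eq_padicNorm p]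
  have h0 : 0 < ‖(n : ℚ_[p])‖ := by
    rw [norm_pos_iff]; exact_mod_cast hn
  rw [inv_le_iff_one_le_mul₀ h0]
  exact h

theorem charZero_of_padic (p : ℕ) [Fact p.Prime] (F : Type*) [NormedField F]
    [NormedAlgebra ℚ_[p] F] : CharZero F :=
  Algebra.charZero_of_charZero ℚ_[p] F

theorem tendsto_prime_pow_natCast : Tendsto (fun n : ℕ => ((p ^ n : ℕ) : F)) atTop (𝓝 0) := by
  push_cast
  refine tendsto_pow_atTop_nhds_zero_of_norm_lt_one ?_
  rw [norm_natCast_eq_padicNorm p]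
  exact Padic.norm_p_lt_one

theorem tendsto_choose_prime_pow_sub_one (k : ℕ) :
    Tendsto (fun n : ℕ => (((p ^ n - 1).choose k : ℕ) : F)) atTop (𝓝 ((-1) ^ k)) := by
  have := charZero_of_padic p F
  induction k with
  | zero => simp
  | succ k ih =>
    -- With `N + 1 = p^n`, `C(N, k+1) = (N + 1) C(N, k) / (k + 1) - C(N, k)`; the first term tends
    -- to `0` because `p^n` does.
    have h1 : Tendsto (fun n : ℕ => ((p ^ n : ℕ) : F) * ((p ^ n - 1).choose k : ℕ) / ((k : F) + 1) -
        ((p ^ n - 1).choose k : ℕ)) atTop (𝓝 ((-1) ^ (k + 1))) := by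
      have := (((tendsto_prime_pow_natCast (p := p)).mul ih).div_const ((k : F) + 1)).sub ih
      simpa [pow_succ] using this
    refine h1.congr fun n => ?_
    obtain ⟨N, hN⟩ : ∃ N, p ^ n = N + 1 :=
      ⟨p ^ n - 1, by have := pow_pos (Fact.out : p.Prime).pos n; omega⟩
    rw [hN, Nat.add_sub_cancel]
    have e1 : ((N + 1 : ℕ) : F) * (N.choose k : ℕ) = ((N + 1).choose (k + 1) : ℕ) * ((k : F) + 1) := by
      exact_mod_cast Nat.add_one_mul_choose_eq N k
    have e2 : (((N + 1).choose (k + 1) : ℕ) : F) = (N.choose k : ℕ) + (N.choose (k + 1) : ℕ) := by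
      exact_mod_cast Nat.choose_succ_succ N k
    have hk : (k : F) + 1 ≠ 0 := by exact_mod_cast k.succ_ne_zero
    rw [e1, e2]
    field_simp
    ring

theorem norm_logTerm_le (p : ℕ) [Fact p.Prime] {F : Type*} [NormedField F]
    [NormedAlgebra ℚ_[p] F]
    {x c : F} (hc : ‖c‖ ≤ 1) (k : ℕ) :
    ‖c * x ^ (k + 1) / ((k : F) + 1)‖ ≤ ((k + 1 : ℕ) : ℝ) * ‖x‖ ^ (k + 1) := by
  have h := inv_norm_natCast_le p (F := F) (k + 1) k.succ_ne_zero
  rw [norm_div, norm_mul, norm_pow, div_eq_mul_inv, mul_comm]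
  push_cast at h ⊢
  refine mul_le_mul h ?_ (by positivity) (by positivity)
  exact mul_le_of_le_one_left (by positivity) hc

theorem summable_succ_mul_pow {r : ℝ} (h0 : 0 ≤ r) (h : r < 1) :
    Summable fun k : ℕ => ((k + 1 : ℕ) : ℝ) * r ^ (k + 1) := by
  have := summable_pow_mul_geometric_of_norm_lt_one (R := ℝ) 1 (r := r)
    (by rwa [Real.norm_of_nonneg h0])
  simpa using (summable_nat_add_iff 1).2 this

theorem one_add_pow_sub_one_div (x : F) [CharZero F] {N : ℕ} (hN : N ≠ 0) :
    ((1 + x) ^ N - 1) / N = ∑' k : ℕ, ((N - 1).choose k : F) * x ^ (k + 1) / ((k : F) + 1) := by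
  rw [tsum_eq_sum (s := Finset.range N)]
  · rw [add_comm 1 x, add_pow, Finset.sum_range_succ']
    simp only [one_pow, mul_one, pow_zero, Nat.choose_zero_right, Nat.cast_one, add_sub_cancel_right]
    rw [Finset.sum_div]
    refine Finset.sum_congr rfl fun k _ => ?_
    obtain ⟨M, rfl⟩ := Nat.exists_eq_succ_of_ne_zero hN
    have e1 : ((M + 1 : ℕ) : F) * (M.choose k : ℕ) = ((M + 1).choose (k + 1) : ℕ) * ((k : F) + 1) := by
      exact_mod_cast Nat.add_one_mul_choose_eq M k
    have hk : (k : F) + 1 ≠ 0 := by exact_mod_cast k.succ_ne_zero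
    have hM : ((M + 1 : ℕ) : F) ≠ 0 := by exact_mod_cast M.succ_ne_zero
    simp only [Nat.succ_eq_add_one, Nat.add_sub_cancel]
    rw [div_eq_div_iff hM hk]
    linear_combination -x ^ (k + 1) * e1
  · intro k hk
    rw [Finset.mem_range, not_lt] at hk
    rw [Nat.choose_eq_zero_of_lt (by omega)]
    simp

theorem summable_logTerm (p : ℕ) [Fact p.Prime] {F : Type*} [NormedField F]
    [NormedAlgebra ℚ_[p] F]
    [CompleteSpace F] {x : F} (hx : ‖x‖ < 1) :
    Summable fun k : ℕ => (-1) ^ k * x ^ (k + 1) / ((k : F) + 1) :=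
  Summable.of_norm_bounded (summable_succ_mul_pow (norm_nonneg x) hx) fun k =>
    norm_logTerm_le p (by simp) k

/-- The binomial expansion has coefficients `C(p^n - 1, k) / (k + 1)`, and the binomial tends to
`(-1)^k`. Dominated convergence applies because `‖1 / (k + 1)‖ ≤ k + 1`. -/
theorem tendsto_one_add_pow_sub_one_div [CompleteSpace F] {x : F} (hx : ‖x‖ < 1) :
    Tendsto (fun n : ℕ => ((1 + x) ^ p ^ n - 1) / ((p ^ n : ℕ) : F)) atTop
      (𝓝 (∑' k : ℕ, (-1) ^ k * x ^ (k + 1) / ((k : F) + 1))) := by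
  have := charZero_of_padic p F
  have h := tendsto_tsum_of_dominated_convergence (𝓕 := atTop)
    (f := fun n k : ℕ => ((p ^ n - 1).choose k : F) * x ^ (k + 1) / ((k : F) + 1))
    (summable_succ_mul_pow (norm_nonneg x) hx)
    (fun k => ((tendsto_choose_prime_pow_sub_one (p := p) k).mul_const _).div_const _)
    (Eventually.of_forall fun n k =>
      norm_logTerm_le p (norm_natCast_le_one_of_padic p _) k)
  exact h.congr fun n => (one_add_pow_sub_one_div x (pow_pos (Fact.out : p.Prime).pos n).ne').symm

end LogLimit

/-! ### Additivity, Galois equivariance and isometry of the logarithm. -/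

section PadicLog

variable {p : ℕ} [Fact p.Prime]

/-- The logarithm is the derivative at `0` of `N ↦ y ^ N` along the powers of `p`. -/
theorem tendsto_padicLog {y : PadicAlgCl p} (hy : ‖y - 1‖ < 1) :
    Tendsto (fun n : ℕ => (y ^ p ^ n - 1) / ((p ^ n : ℕ) : PadicAlgCl p)) atTop
      (𝓝 (padicLog p y)) := by
  -- The limit formula needs completeness, which the finite extension `ℚ_p(y)` has.
  let K := IntermediateField.adjoin ℚ_[p] {y}
  have : FiniteDimensional ℚ_[p] K :=
    IntermediateField.adjoin.finiteDimensional (Algebra.IsIntegral.isIntegral y)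
  have : CompleteSpace K := FiniteDimensional.complete ℚ_[p] K
  let x : K := ⟨y, IntermediateField.mem_adjoin_simple_self _ y⟩ - 1
  have hxy : (x : PadicAlgCl p) = y - 1 := rfl
  have hx : ‖x‖ < 1 := hy
  have hcont : Continuous (algebraMap K (PadicAlgCl p)) := continuous_subtype_val
  have hsum := ((summable_logTerm p hx).hasSum.map (algebraMap K (PadicAlgCl p)) hcont).tsum_eq
  have hlim := (hcont.tendsto _).comp (tendsto_one_add_pow_sub_one_div (p := p) hx)
  rw [← hsum] at hlim
  have e : padicLog p y =
      ∑' k : ℕ, algebraMap K (PadicAlgCl p) ((-1) ^ k * x ^ (k + 1) / ((k : K) + 1)) :=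
    tsum_congr fun k => by simp [IntermediateField.algebraMap_apply, hxy]
  rw [e]
  exact hlim.congr fun n => by simp [IntermediateField.algebraMap_apply, hxy]

theorem PadicAlgCl.norm_eq_one_of_norm_sub_one_lt {y : PadicAlgCl p} (hy : ‖y - 1‖ < 1) :
    ‖y‖ = 1 := by
  have := IsUltrametricDist.norm_add_eq_max_of_norm_ne_norm (x := y - 1) (y := 1)
    (by rw [norm_one]; exact hy.ne)
  rw [sub_add_cancel, norm_one, max_eq_right hy.le] at this
  exact this

theorem PadicAlgCl.norm_mul_sub_one_lt {x y : PadicAlgCl p} {r : ℝ} (hr : r ≤ 1)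
    (hx : ‖x - 1‖ < r) (hy : ‖y - 1‖ < r) : ‖x * y - 1‖ < r := by
  have e : x * y - 1 = x * (y - 1) + (x - 1) := by ring
  rw [e]
  refine (IsUltrametricDist.norm_add_le_max _ _).trans_lt (max_lt ?_ hx)
  rwa [norm_mul, norm_eq_one_of_norm_sub_one_lt (hx.trans_le hr), one_mul]

theorem PadicAlgCl.norm_inv_sub_one {y : PadicAlgCl p} (hy : ‖y - 1‖ < 1) :
    ‖y⁻¹ - 1‖ = ‖y - 1‖ := by
  have h1 := norm_eq_one_of_norm_sub_one_lt hy
  have h0 : y ≠ 0 := by rintro rfl; simp at h1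
  have e : y⁻¹ - 1 = -(y⁻¹ * (y - 1)) := by field_simp; ring
  rw [e, norm_neg, norm_mul, norm_inv, h1, inv_one, one_mul]

theorem PadicAlgCl.norm_pow_sub_one_lt {y : PadicAlgCl p} {r : ℝ} (hr : r ≤ 1)
    (hy : ‖y - 1‖ < r) (n : ℕ) : ‖y ^ n - 1‖ < r := by
  induction n with
  | zero => simpa using (norm_nonneg _).trans_lt hy
  | succ n ih => rw [pow_succ]; exact norm_mul_sub_one_lt hr ih hy

theorem padicLog_mul {x y : PadicAlgCl p} (hx : ‖x - 1‖ < 1) (hy : ‖y - 1‖ < 1) :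
    padicLog p (x * y) = padicLog p x + padicLog p y := by
  have hp : ∀ n : ℕ, ((p ^ n : ℕ) : PadicAlgCl p) ≠ 0 := fun n => by
    exact_mod_cast (pow_pos (Fact.out : p.Prime).pos n).ne'
  -- With `a = (x^N - 1)/N` and `b = (y^N - 1)/N`, one has `((xy)^N - 1)/N = a + b + abN`, and `N =
  -- p^n` tends to `0`.
  have h := ((tendsto_padicLog hx).add (tendsto_padicLog hy)).add
    (((tendsto_padicLog hx).mul (tendsto_padicLog hy)).mul
      (tendsto_prime_pow_natCast (p := p) (F := PadicAlgCl p)))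
  rw [mul_zero, add_zero] at h
  refine tendsto_nhds_unique (tendsto_padicLog (PadicAlgCl.norm_mul_sub_one_lt le_rfl hx hy))
    (h.congr fun n => ?_)
  have := hp n
  field_simp
  ring

theorem padicLog_one : padicLog p 1 = 0 := by
  simp [padicLog]

theorem padicLog_inv {y : PadicAlgCl p} (hy : ‖y - 1‖ < 1) :
    padicLog p y⁻¹ = -padicLog p y := by
  have h1 := PadicAlgCl.norm_eq_one_of_norm_sub_one_lt hy
  have h0 : y ≠ 0 := by rintro rfl; simp at h1
  have := padicLog_mul hy ((PadicAlgCl.norm_inv_sub_one hy).trans_lt hy)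
  rw [mul_inv_cancel₀ h0, padicLog_one] at this
  linear_combination -this

theorem padicLog_pow {y : PadicAlgCl p} (hy : ‖y - 1‖ < 1) (n : ℕ) :
    padicLog p (y ^ n) = n * padicLog p y := by
  induction n with
  | zero => simp [padicLog_one]
  | succ n ih =>
    rw [pow_succ, padicLog_mul (PadicAlgCl.norm_pow_sub_one_lt le_rfl hy n) hy, ih]
    push_cast; ring

theorem PadicAlgCl.norm_algEquiv (σ : PadicAlgCl p ≃ₐ[ℚ_[p]] PadicAlgCl p) (x : PadicAlgCl p) :
    ‖σ x‖ = ‖x‖ :=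
  (spectralNorm_eq_of_equiv σ x).symm

theorem padicLog_algEquiv (σ : PadicAlgCl p ≃ₐ[ℚ_[p]] PadicAlgCl p) {y : PadicAlgCl p}
    (hy : ‖y - 1‖ < 1) : padicLog p (σ y) = σ (padicLog p y) := by
  have hσ : Continuous σ :=
    (AddMonoidHomClass.isometry_of_norm σ (PadicAlgCl.norm_algEquiv σ)).continuous
  have hy' : ‖σ y - 1‖ < 1 := by
    rwa [← map_one σ, ← map_sub, PadicAlgCl.norm_algEquiv]
  refine tendsto_nhds_unique (tendsto_padicLog hy')
    (((hσ.tendsto _).comp (tendsto_padicLog hy)).congr fun n => ?_)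
  simp

theorem norm_two_padicAlgCl : ‖(2 : PadicAlgCl 2)‖ = 1 / 2 := by
  have h := norm_natCast_eq_padicNorm 2 (PadicAlgCl 2) 2
  have h2 := Padic.norm_p (p := 2)
  push_cast at h h2
  rw [h, h2]; norm_num

theorem norm_pow_two_pow_sub_one {y : PadicAlgCl 2} (hy : ‖y - 1‖ < 1 / 2) (n : ℕ) :
    ‖y ^ 2 ^ n - 1‖ = (1 / 2) ^ n * ‖y - 1‖ := by
  induction n with
  | zero => simp
  | succ n ih =>
    -- In the second factor the summand `2` dominates, so each squaring halves the distance to `1`.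
    have e : y ^ 2 ^ (n + 1) - 1 = (y ^ 2 ^ n - 1) * ((y ^ 2 ^ n - 1) + 2) := by
      rw [pow_succ, pow_mul]; ring
    have hlt : ‖y ^ 2 ^ n - 1‖ < 1 / 2 := by
      rw [ih]
      exact (mul_le_of_le_one_left (norm_nonneg _)
        (pow_le_one₀ (by norm_num) (by norm_num))).trans_lt hy
    rw [e, norm_mul, IsUltrametricDist.norm_add_eq_max_of_norm_ne_norm
      (by rw [norm_two_padicAlgCl]; exact hlt.ne), norm_two_padicAlgCl, max_eq_right hlt.le, ih]
    ring

/-- The quotients converging to the logarithm have constant norm: division by `2^n` exactly undoes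
the contraction under repeated squaring. -/
theorem norm_padicLog_two {y : PadicAlgCl 2} (hy : ‖y - 1‖ < 1 / 2) :
    ‖padicLog 2 y‖ = ‖y - 1‖ := by
  refine tendsto_nhds_unique (tendsto_padicLog (hy.trans (by norm_num))).norm
    (tendsto_const_nhds.congr fun n => ?_)
  rw [norm_div, norm_pow_two_pow_sub_one hy]
  push_cast
  rw [norm_pow, norm_two_padicAlgCl]
  field_simp

end PadicLog

theorem padicIntToAlgCl_injective (p : ℕ) [Fact p.Prime] :
    Function.Injective (padicIntToAlgCl p) :=
  (algebraMap ℚ_[p] (PadicAlgCl p)).injective.comp Subtype.coe_injective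

theorem norm_padicIntToAlgCl {p : ℕ} [Fact p.Prime] (x : ℤ_[p]) : ‖padicIntToAlgCl p x‖ = ‖x‖ := by
  change ‖algebraMap ℚ_[p] (PadicAlgCl p) (x : ℚ_[p])‖ = ‖x‖
  rw [norm_algebraMap', PadicInt.padic_norm_e_of_padicInt]

/-- The element `2 ^ k (1 + 2 x)` has valuation `k`. -/
theorem norm_two_pow_mul_odd (k : ℕ) (x : ℤ_[2]) :
    ‖2 ^ k * (1 + 2 * padicIntToAlgCl 2 x)‖ = (1 / 2) ^ k := by
  have h : ‖2 * padicIntToAlgCl 2 x‖ < 1 := by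
    rw [norm_mul, norm_two_padicAlgCl, norm_padicIntToAlgCl]
    have := PadicInt.norm_le_one x
    linarith
  rw [norm_mul, norm_pow, norm_two_padicAlgCl, IsUltrametricDist.norm_add_eq_max_of_norm_ne_norm
    (by rw [norm_one]; exact h.ne'), norm_one, max_eq_left h.le, mul_one]

theorem interpolation_coeffs {F : Type*} [Field F] (u v w : F) {a b c : F} (hab : a - b ≠ 0)
    (hac : a - c ≠ 0) (hcb : c - b ≠ 0) :
    let x := (u * (b * c) - v * (b + c) + w) / ((a - b) * (a - c))
    let y := (-u * c * a + v * (c + a) - w) / ((c - b) * (b - a))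
    let z := (-u * a * b + v * (a + b) - w) / ((a - c) * (c - b))
    u = x * a ^ 0 + y * b ^ 0 + z * c ^ 0 ∧ v = x * a ^ 1 + y * b ^ 1 + z * c ^ 1 ∧
      w = x * a ^ 2 + y * b ^ 2 + z * c ^ 2 := by
  have e : (c - b) * (b - a) = -((c - b) * (a - b)) := by ring
  intro x y z
  simp only [x, y, z, e]
  refine ⟨?_, ?_, ?_⟩ <;> field_simp <;> ring

/-- The coefficient `c₁` in `U_i = c₁ β₁^i + c₂ β₂^i + c₃ β₃^i`. -/
noncomputable def toyC₁ (β₁ β₂ β₃ : PadicAlgCl 2) : PadicAlgCl 2 :=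
  (toyU 0 * (β₂ * β₃) - toyU 1 * (β₂ + β₃) + toyU 2) / ((β₁ - β₂) * (β₁ - β₃))

/-! ### Valuations of the roots and of the coefficients. -/

namespace IsToyRoots

variable {β₁ : ℤ_[2]} {β₂ β₃ : PadicAlgCl 2}

local notation "B" => padicIntToAlgCl 2 β₁

theorem symm (h : IsToyRoots β₁ β₂ β₃) : IsToyRoots β₁ β₃ β₂ :=
  ⟨h.modFour, by rw [h.factor]; ring⟩

theorem eval_eq (h : IsToyRoots β₁ β₂ β₃) (x : PadicAlgCl 2) :
    x ^ 3 - 12 * x ^ 2 - 6 * x - 12 = (x - B) * (x - β₂) * (x - β₃) := by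
  simpa using congrArg (eval x) h.factor

theorem add_eq (h : IsToyRoots β₁ β₂ β₃) : β₂ + β₃ = 12 - B := by
  have h0 := h.eval_eq 0
  have h1 := h.eval_eq 1
  have h2 := h.eval_eq (-1)
  have h3 : (2 : PadicAlgCl 2) * (β₂ + β₃ - (12 - B)) = 0 := by
    linear_combination h1 + h2 - 2 * h0
  have := (mul_eq_zero.1 h3).resolve_left two_ne_zero
  linear_combination this

theorem mul_eq (h : IsToyRoots β₁ β₂ β₃) : β₂ * β₃ = B ^ 2 - 12 * B - 6 := by
  have h0 := h.eval_eq 0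
  have h1 := h.eval_eq 1
  have h2 := h.add_eq
  linear_combination -h1 + h0 + (1 - B) * h2

theorem root_eq (h : IsToyRoots β₁ β₂ β₃) : β₁ ^ 3 - 12 * β₁ ^ 2 - 6 * β₁ - 12 = 0 := by
  apply padicIntToAlgCl_injective 2
  have := h.eval_eq B
  simp only [map_sub, map_mul, map_pow, map_zero, map_ofNat]
  rw [this]; ring

/-- A hand-made Hensel refinement of `β₁ ≡ 2 (mod 4)`. Writing `β₁ = 34 + 64x` turns symmetric
expressions in the roots into `2^k` times an explicit odd number, from which the norms below are
read off. -/
theorem exists_eq (h : IsToyRoots β₁ β₂ β₃) : ∃ x : ℤ_[2], β₁ = 34 + 64 * x := by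
  obtain ⟨w, hw⟩ := h.modFour
  obtain rfl : β₁ = 2 + 4 * w := by linear_combination hw
  have h8 : (8 : ℤ_[2]) * (8 * w ^ 3 - 12 * w ^ 2 - 21 * w - 8) = 0 := by
    linear_combination h.root_eq
  have hw0 := (mul_eq_zero.1 h8).resolve_left (by norm_num)
  set t := 2 * w ^ 3 - 3 * w ^ 2 - 5 * w - 2 with ht
  have hwt : w = 4 * t := by linear_combination -hw0
  rw [hwt] at hw0
  have ht0 : 21 * t = 128 * t ^ 3 - 48 * t ^ 2 - 2 := by
    refine mul_left_cancel₀ (show (4 : ℤ_[2]) ≠ 0 by norm_num) ?_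
    linear_combination -hw0
  clear_value t
  set v := 64 * t ^ 3 - 24 * t ^ 2 - 10 * t - 1 with hv
  have htv : t = 2 * v := by linear_combination ht0
  rw [htv] at ht0
  have hv0 : 21 * v = 512 * v ^ 3 - 96 * v ^ 2 - 1 := by
    refine mul_left_cancel₀ (show (2 : ℤ_[2]) ≠ 0 by norm_num) ?_
    linear_combination ht0
  clear_value v
  -- Here `β₁ = 2 + 32v`, and the relation for `v` reads `v = 1 + 2x` with this witness `x`.
  refine ⟨256 * v ^ 3 - 48 * v ^ 2 - 10 * v - 1, ?_⟩
  rw [hwt, htv]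
  linear_combination 32 * hv0

theorem map_eq {x : ℤ_[2]} (hx : β₁ = 34 + 64 * x) : B = 34 + 64 * padicIntToAlgCl 2 x := by
  rw [hx]; simp only [map_add, map_mul, map_ofNat]

theorem norm_root (h : IsToyRoots β₁ β₂ β₃) : ‖B‖ = 1 / 2 := by
  obtain ⟨x, hx⟩ := h.exists_eq
  have := norm_two_pow_mul_odd 1 (8 + 16 * x)
  rw [show B = 2 ^ 1 * (1 + 2 * padicIntToAlgCl 2 (8 + 16 * x)) by
    rw [map_eq hx]; simp only [map_add, map_mul, map_ofNat]; ring, this]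
  norm_num

theorem norm_add (h : IsToyRoots β₁ β₂ β₃) : ‖β₂ + β₃‖ = 1 / 2 := by
  obtain ⟨x, hx⟩ := h.exists_eq
  have := norm_two_pow_mul_odd 1 (-6 - 16 * x)
  rw [show β₂ + β₃ = 2 ^ 1 * (1 + 2 * padicIntToAlgCl 2 (-6 - 16 * x)) by
    rw [h.add_eq, map_eq hx]; simp only [map_sub, map_mul, map_neg, map_ofNat]; ring, this]
  norm_num

theorem norm_mul (h : IsToyRoots β₁ β₂ β₃) : ‖β₂‖ * ‖β₃‖ = 1 / 2 := by
  obtain ⟨x, hx⟩ := h.exists_eq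
  have := norm_two_pow_mul_odd 1 (185 + 896 * x + 1024 * x ^ 2)
  rw [← _root_.norm_mul, show β₂ * β₃ = 2 ^ 1 * (1 + 2 * padicIntToAlgCl 2
    (185 + 896 * x + 1024 * x ^ 2)) by
    rw [h.mul_eq, map_eq hx]; simp only [map_add, map_mul, map_pow, map_ofNat]; ring, this]
  norm_num

/-- If the norms differed, the larger would equal `‖β₂ + β₃‖ = 1/2`, making the product less than
`1/2`. -/
theorem norm_eq (h : IsToyRoots β₁ β₂ β₃) : ‖β₂‖ = ‖β₃‖ := by
  by_contra hne
  have h1 := IsUltrametricDist.norm_add_eq_max_of_norm_ne_norm hne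
  have h2 := h.norm_mul
  rw [h.norm_add] at h1
  rcases max_choice ‖β₂‖ ‖β₃‖ with h3 | h3
  · rw [h3] at h1
    have := le_max_right ‖β₂‖ ‖β₃‖
    rw [h3] at this
    rw [← h1] at h2 this
    linarith
  · rw [h3] at h1
    have := le_max_left ‖β₂‖ ‖β₃‖
    rw [h3] at this
    rw [← h1] at h2 this
    linarith

theorem norm_sq (h : IsToyRoots β₁ β₂ β₃) : ‖β₂‖ ^ 2 = 1 / 2 := by
  rw [← h.norm_mul, ← h.norm_eq, sq]

theorem norm_lt_one (h : IsToyRoots β₁ β₂ β₃) : ‖β₂‖ < 1 := by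
  have := h.norm_sq
  nlinarith [norm_nonneg β₂]

theorem half_lt_norm (h : IsToyRoots β₁ β₂ β₃) : 1 / 2 < ‖β₂‖ := by
  have := h.norm_sq
  nlinarith [norm_nonneg β₂]

theorem norm_sub (h : IsToyRoots β₁ β₂ β₃) : ‖β₃ - β₂‖ = 1 / 2 := by
  obtain ⟨x, hx⟩ := h.exists_eq
  have h1 := norm_two_pow_mul_odd 2 (-311 - 1440 * x - 1536 * x ^ 2)
  have h2 : ‖β₃ - β₂‖ ^ 2 = (1 / 2) ^ 2 := by
    rw [← norm_pow, ← h1]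
    congr 1
    have e : (β₃ - β₂) ^ 2 = (β₂ + β₃) ^ 2 - 4 * (β₂ * β₃) := by ring
    rw [e, h.add_eq, h.mul_eq, map_eq hx]; simp only [map_sub, map_mul, map_pow, map_neg, map_ofNat]; ring
  exact (pow_left_inj₀ (norm_nonneg _) (by norm_num) two_ne_zero).1 h2

theorem norm_sub_root (h : IsToyRoots β₁ β₂ β₃) : ‖β₂ - B‖ = ‖β₂‖ := by
  have h1 := h.half_lt_norm
  rw [sub_eq_add_neg, IsUltrametricDist.norm_add_eq_max_of_norm_ne_norm
    (by rw [norm_neg, h.norm_root]; exact h1.ne'), norm_neg, h.norm_root, max_eq_left h1.le]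

theorem norm_ratio_pow_sub_one (h : IsToyRoots β₁ β₂ β₃) : ‖(β₃ / β₂) ^ 4 - 1‖ = 1 / 8 := by
  obtain ⟨x, hx⟩ := h.exists_eq
  have h1 := norm_two_pow_mul_odd 3 (-63 - 272 * x - 256 * x ^ 2)
  have h0 : β₂ ≠ 0 := norm_pos_iff.1 ((by norm_num : (0 : ℝ) < 1 / 2).trans h.half_lt_norm)
  -- `β₃⁴ - β₂⁴ = (β₃ - β₂)(β₂ + β₃)(β₂² + β₃²)`, with factors of norm `1/2`, `1/2` and `1/8`.
  have e : (β₃ / β₂) ^ 4 - 1 = (β₃ - β₂) * (β₂ + β₃) *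
      (2 ^ 3 * (1 + 2 * padicIntToAlgCl 2 (-63 - 272 * x - 256 * x ^ 2))) / β₂ ^ 4 := by
    have e2 : (2 ^ 3 * (1 + 2 * padicIntToAlgCl 2 (-63 - 272 * x - 256 * x ^ 2))) =
        (β₂ + β₃) ^ 2 - 2 * (β₂ * β₃) := by
      rw [h.add_eq, h.mul_eq, map_eq hx]; simp only [map_sub, map_mul, map_pow, map_neg, map_ofNat]; ring
    rw [e2]
    field_simp
    ring
  have h4 : ‖β₂‖ ^ 4 = 1 / 4 := by
    rw [show ‖β₂‖ ^ 4 = (‖β₂‖ ^ 2) ^ 2 by ring, h.norm_sq]; norm_num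
  rw [e, norm_div, _root_.norm_mul, _root_.norm_mul, h1, h.norm_sub, h.norm_add, norm_pow, h4]
  norm_num

theorem norm_coeff_numerator (h : IsToyRoots β₁ β₂ β₃) :
    ‖-(toyU 0 : PadicAlgCl 2) * β₃ * B + toyU 1 * (β₃ + B) - toyU 2‖ = 1 := by
  obtain ⟨x, hx⟩ := h.exists_eq
  have h1 := norm_two_pow_mul_odd 0 (139 + 416 * x)
  have e : -(toyU 0 : PadicAlgCl 2) * β₃ * B + toyU 1 * (β₃ + B) - toyU 2 =
      β₃ * padicIntToAlgCl 2 (13 - β₁) + 2 ^ 0 * (1 + 2 * padicIntToAlgCl 2 (139 + 416 * x)) := by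
    simp only [map_sub, map_add, map_mul, map_ofNat, toyU]
    rw [map_eq hx]
    push_cast
    ring
  have hlt : ‖β₃ * padicIntToAlgCl 2 (13 - β₁)‖ < 1 := by
    rw [_root_.norm_mul, norm_padicIntToAlgCl]
    exact (mul_le_of_le_one_right (norm_nonneg _) (PadicInt.norm_le_one _)).trans_lt
      h.symm.norm_lt_one
  rw [pow_zero] at h1
  rw [e, IsUltrametricDist.norm_add_eq_max_of_norm_ne_norm (by rw [pow_zero, h1, pow_zero]; exact hlt.ne),
    pow_zero, h1, pow_zero, max_eq_right hlt.le]

theorem toyC₃_eq (β₁ β₂ β₃ : PadicAlgCl 2) : toyC₃ β₁ β₂ β₃ = toyC₂ β₁ β₃ β₂ := by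
  unfold toyC₂ toyC₃
  rw [show (β₁ - β₃) * (β₃ - β₂) = (β₂ - β₃) * (β₃ - β₁) by ring,
    show -(toyU 0 : PadicAlgCl 2) * β₁ * β₂ + toyU 1 * (β₁ + β₂) - toyU 2 =
      -(toyU 0 : PadicAlgCl 2) * β₂ * β₁ + toyU 1 * (β₂ + β₁) - toyU 2 by ring]

theorem norm_coeff_mul (h : IsToyRoots β₁ β₂ β₃) : ‖toyC₂ B β₂ β₃ * β₂‖ = 2 := by
  have h0 : ‖β₂‖ ≠ 0 := ((by norm_num : (0 : ℝ) < 1 / 2).trans h.half_lt_norm).ne'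
  rw [toyC₂, _root_.norm_mul, norm_div, _root_.norm_mul, h.norm_coeff_numerator, h.norm_sub,
    h.norm_sub_root]
  field_simp

theorem norm_coeff_mul' (h : IsToyRoots β₁ β₂ β₃) : ‖toyC₃ B β₂ β₃ * β₃‖ = 2 := by
  rw [toyC₃_eq]; exact h.symm.norm_coeff_mul

theorem sub_ne_zero (h : IsToyRoots β₁ β₂ β₃) : β₃ - β₂ ≠ 0 :=
  norm_pos_iff.1 (by rw [h.norm_sub]; norm_num)

theorem sub_root_ne_zero (h : IsToyRoots β₁ β₂ β₃) : β₂ - B ≠ 0 :=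
  norm_pos_iff.1 (by rw [h.norm_sub_root]; linarith [h.half_lt_norm])

/-- The coefficients solve the interpolation problem at indices 0, 1, 2, and both sides satisfy the
same recurrence. -/
theorem toyU_eq (h : IsToyRoots β₁ β₂ β₃) (i : ℕ) :
    (toyU i : PadicAlgCl 2) =
      toyC₁ B β₂ β₃ * B ^ i + toyC₂ B β₂ β₃ * β₂ ^ i + toyC₃ B β₂ β₃ * β₃ ^ i := by
  have h1 := h.sub_ne_zero
  have h2 := h.sub_root_ne_zero
  have h3 := h.symm.sub_root_ne_zero
  have h2' : B - β₂ ≠ 0 := by rw [← neg_sub]; exact neg_ne_zero.2 h2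
  have h3' : B - β₃ ≠ 0 := by rw [← neg_sub]; exact neg_ne_zero.2 h3
  have r1 := h.eval_eq B
  have r2 := h.eval_eq β₂
  have r3 := h.eval_eq β₃
  simp only [sub_self, mul_zero, zero_mul] at r1 r2 r3
  obtain ⟨b0, b1, b2⟩ := interpolation_coeffs (toyU 0 : PadicAlgCl 2) (toyU 1) (toyU 2) h2' h3' h1
  induction i using Nat.strong_induction_on with
  | _ i ih =>
    match i, ih with
    | 0, _ => exact b0
    | 1, _ => exact b1
    | 2, _ => exact b2
    | j + 3, ih =>
      have e : (toyU (j + 3) : PadicAlgCl 2) =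
          12 * toyU (j + 2) + 6 * toyU (j + 1) + 12 * toyU j := by
        simp only [toyU]; push_cast; ring
      rw [e, ih (j + 2) (by omega), ih (j + 1) (by omega), ih j (by omega)]
      linear_combination -toyC₁ B β₂ β₃ * B ^ j * r1 - toyC₂ B β₂ β₃ * β₂ ^ j * r2 -
        toyC₃ B β₂ β₃ * β₃ ^ j * r3

theorem norm_toyC₁ (h : IsToyRoots β₁ β₂ β₃) : ‖toyC₁ B β₂ β₃‖ = 2 := by
  obtain ⟨x, hx⟩ := h.exists_eq
  have h1 := norm_two_pow_mul_odd 0 (595 + 2208 * x + 2048 * x ^ 2)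
  have e : (toyU 0 * (β₂ * β₃) - toyU 1 * (β₂ + β₃) + toyU 2 : PadicAlgCl 2) =
      2 ^ 0 * (1 + 2 * padicIntToAlgCl 2 (595 + 2208 * x + 2048 * x ^ 2)) := by
    rw [h.add_eq, h.mul_eq, map_eq hx]; simp only [toyU]; push_cast
    simp only [map_add, map_mul, map_pow, map_ofNat]; ring
  rw [toyC₁, norm_div, e, h1, _root_.norm_mul, norm_sub_rev, h.norm_sub_root, norm_sub_rev,
    h.symm.norm_sub_root, h.norm_mul]
  norm_num

/-- The difference is `-(c₂β₂ + c₃β₃)/(c₃β₃)`, and `c₂β₂ + c₃β₃ = U₁ - c₁β₁` is a rational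
expression in `β₁` once its denominator `(β₁ - β₂)(β₁ - β₃)` is expanded. -/
theorem norm_coeff_ratio_sub_one (h : IsToyRoots β₁ β₂ β₃) :
    ‖-(toyC₂ B β₂ β₃ * β₂ / (toyC₃ B β₂ β₃ * β₃)) - 1‖ = 1 / 16 := by
  obtain ⟨x, hx⟩ := h.exists_eq
  have h1 := norm_two_pow_mul_odd 4 (597 + 2898 * x + 3328 * x ^ 2)
  have hc : toyC₃ B β₂ β₃ * β₃ ≠ 0 := norm_pos_iff.1 (by rw [h.norm_coeff_mul']; norm_num)
  have hB2 : B - β₂ ≠ 0 := by rw [← neg_sub]; exact neg_ne_zero.2 h.sub_root_ne_zero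
  have hB3 : B - β₃ ≠ 0 := by rw [← neg_sub]; exact neg_ne_zero.2 h.symm.sub_root_ne_zero
  have e : -(toyC₂ B β₂ β₃ * β₂ / (toyC₃ B β₂ β₃ * β₃)) - 1 =
      -(2 ^ 4 * (1 + 2 * padicIntToAlgCl 2 (597 + 2898 * x + 3328 * x ^ 2)) /
        ((B - β₂) * (B - β₃)) / (toyC₃ B β₂ β₃ * β₃)) := by
    have e1 := h.toyU_eq 1
    simp only [pow_one] at e1
    have e2 : toyC₁ B β₂ β₃ * ((B - β₂) * (B - β₃)) =
        toyU 0 * (β₂ * β₃) - toyU 1 * (β₂ + β₃) + toyU 2 :=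
      div_mul_cancel₀ _ (mul_ne_zero hB2 hB3)
    have e3 : 2 ^ 4 * (1 + 2 * padicIntToAlgCl 2 (597 + 2898 * x + 3328 * x ^ 2)) /
        ((B - β₂) * (B - β₃)) = toyC₂ B β₂ β₃ * β₂ + toyC₃ B β₂ β₃ * β₃ := by
      rw [div_eq_iff (mul_ne_zero hB2 hB3)]
      have e4 : toyC₂ B β₂ β₃ * β₂ + toyC₃ B β₂ β₃ * β₃ = toyU 1 - toyC₁ B β₂ β₃ * B := by
        rw [e1]; ring
      have e5 : (toyU 1 - toyC₁ B β₂ β₃ * B) * ((B - β₂) * (B - β₃)) =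
          toyU 1 * ((B - β₂) * (B - β₃)) -
            (toyU 0 * (β₂ * β₃) - toyU 1 * (β₂ + β₃) + toyU 2) * B := by
        rw [← e2]; ring
      have e6 : (B - β₂) * (B - β₃) = B ^ 2 - B * (β₂ + β₃) + β₂ * β₃ := by ring
      have r1 := h.eval_eq B
      simp only [sub_self, zero_mul] at r1
      rw [e4, e5, e6, h.add_eq, h.mul_eq]
      simp only [toyU]
      -- The right side is the cleared numerator `(U₁ - c₁β₁)(β₁ - β₂)(β₁ - β₃)`, reduced modulo the
      -- cubic satisfied by `β₁`.
      have e7 : 2 ^ 4 * (1 + 2 * padicIntToAlgCl 2 (597 + 2898 * x + 3328 * x ^ 2)) =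
          26 * B ^ 2 - 319 * B - 90 := by
        rw [map_eq hx]; simp only [map_add, map_mul, map_pow, map_ofNat]; ring
      rw [e7]
      push_cast
      linear_combination r1
    rw [e3, add_div, div_self hc]
    ring
  rw [e, norm_neg, norm_div, norm_div, h1, h.norm_coeff_mul', _root_.norm_mul, norm_sub_rev,
    h.norm_sub_root, norm_sub_rev, h.symm.norm_sub_root, h.norm_mul]
  norm_num

/-! ### Galois descent and the construction of `ζ`. -/

theorem algEquiv_root (σ : PadicAlgCl 2 ≃ₐ[ℚ_[2]] PadicAlgCl 2) (x : ℤ_[2]) :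
    σ (padicIntToAlgCl 2 x) = padicIntToAlgCl 2 x :=
  σ.commutes (x : ℚ_[2])

theorem algEquiv_fix_or_swap (h : IsToyRoots β₁ β₂ β₃) (σ : PadicAlgCl 2 ≃ₐ[ℚ_[2]] PadicAlgCl 2) :
    (σ β₂ = β₂ ∧ σ β₃ = β₃) ∨ (σ β₂ = β₃ ∧ σ β₃ = β₂) := by
  have hsum := congrArg σ h.add_eq
  simp only [map_add, map_sub, map_ofNat, algEquiv_root] at hsum
  rw [← h.add_eq] at hsum
  have e : (σ β₂ - B) * (σ β₂ - β₂) * (σ β₂ - β₃) = 0 := by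
    have e2 := congrArg σ (h.eval_eq β₂)
    simp only [map_sub, map_mul, map_pow, map_ofNat, sub_self, mul_zero, zero_mul,
      map_zero] at e2
    rw [← h.eval_eq, e2]
  have hne : σ β₂ - B ≠ 0 := by
    rw [← algEquiv_root σ β₁, ← map_sub]
    exact (map_ne_zero_iff σ σ.injective).2 h.sub_root_ne_zero
  rcases mul_eq_zero.1 e with e | e
  · have e2 := (mul_eq_zero.1 e).resolve_left hne
    exact Or.inl ⟨by linear_combination e2, by linear_combination hsum - e2⟩
  · exact Or.inr ⟨by linear_combination e, by linear_combination hsum - e⟩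

theorem map_toyC₂ (σ : PadicAlgCl 2 ≃ₐ[ℚ_[2]] PadicAlgCl 2) (a b c : PadicAlgCl 2) :
    σ (toyC₂ a b c) = toyC₂ (σ a) (σ b) (σ c) := by
  simp [toyC₂]

/-- By Galois theory it suffices that every automorphism fixes the quotient. One that swaps `β₂` and
`β₃` inverts both arguments, so the two logarithms change sign together. -/
theorem exists_log_ratio (h : IsToyRoots β₁ β₂ β₃) : ∃ z : ℚ_[2],
    algebraMap ℚ_[2] (PadicAlgCl 2) z = padicLog 2 (-(toyC₂ B β₂ β₃ * β₂ / (toyC₃ B β₂ β₃ * β₃))) /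
      padicLog 2 ((β₃ / β₂) ^ 4) := by
  rw [← Set.mem_range, InfiniteGalois.mem_range_algebraMap_iff_fixed]
  intro σ
  have hA : ‖-(toyC₂ B β₂ β₃ * β₂ / (toyC₃ B β₂ β₃ * β₃)) - 1‖ < 1 := by
    rw [h.norm_coeff_ratio_sub_one]; norm_num
  have hq : ‖(β₃ / β₂) ^ 4 - 1‖ < 1 := by rw [h.norm_ratio_pow_sub_one]; norm_num
  rw [map_div₀, ← padicLog_algEquiv σ hA, ← padicLog_algEquiv σ hq]
  rcases h.algEquiv_fix_or_swap σ with ⟨h2, h3⟩ | ⟨h2, h3⟩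
  · simp only [toyC₃_eq, map_neg, map_div₀, map_mul, map_pow, map_toyC₂, algEquiv_root, h2, h3]
  · have eA : σ (-(toyC₂ B β₂ β₃ * β₂ / (toyC₃ B β₂ β₃ * β₃))) =
        (-(toyC₂ B β₂ β₃ * β₂ / (toyC₃ B β₂ β₃ * β₃)))⁻¹ := by
      simp only [toyC₃_eq, map_neg, map_div₀, map_mul, map_toyC₂, algEquiv_root, h2, h3, inv_neg,
        inv_div]
    have eq : σ ((β₃ / β₂) ^ 4) = ((β₃ / β₂) ^ 4)⁻¹ := by
      simp only [map_div₀, map_pow, h2, h3, ← inv_pow, inv_div]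
    rw [eA, eq, padicLog_inv hA, padicLog_inv hq, neg_div_neg_eq]

/-- The number `ζ` is a `2`-adic integer `≡ 9 (mod 16)`, and `‖U_i - c₁ β₁^i‖` is governed by its
distance to `i`. -/
theorem exists_zeta (h : IsToyRoots β₁ β₂ β₃) : ∃ ζ : ℤ_[2],
    padicIntToAlgCl 2 ζ = toyZeta B β₂ β₃ ∧ ‖ζ - 1‖ = 1 / 8 ∧
      ∀ n : ℕ, ‖(toyU (4 * n + 1) : PadicAlgCl 2) - toyC₁ B β₂ β₃ * B ^ (4 * n + 1)‖ =
        (1 / 4) ^ n * ‖((4 * n + 1 : ℕ) : ℤ_[2]) - ζ‖ := by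
  obtain ⟨z, hz⟩ := h.exists_log_ratio
  have nA := h.norm_coeff_ratio_sub_one
  have nq := h.norm_ratio_pow_sub_one
  have hc2 : toyC₂ B β₂ β₃ * β₂ ≠ 0 := norm_pos_iff.1 (by rw [h.norm_coeff_mul]; norm_num)
  have hc3 : toyC₃ B β₂ β₃ * β₃ ≠ 0 := norm_pos_iff.1 (by rw [h.norm_coeff_mul']; norm_num)
  have hc2' : toyC₂ B β₂ β₃ ≠ 0 := left_ne_zero_of_mul hc2
  have hb2 : β₂ ≠ 0 := right_ne_zero_of_mul hc2
  have n4 : ‖(4 : PadicAlgCl 2)‖ = 1 / 4 := by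
    rw [show (4 : PadicAlgCl 2) = 2 * 2 by norm_num, _root_.norm_mul, norm_two_padicAlgCl]
    norm_num
  have hU : ∀ n : ℕ, (toyU (4 * n + 1) : PadicAlgCl 2) - toyC₁ B β₂ β₃ * B ^ (4 * n + 1) =
      -(toyC₂ B β₂ β₃ * β₂) * β₂ ^ (4 * n) * (((β₃ / β₂) ^ 4) ^ n *
        (-(toyC₂ B β₂ β₃ * β₂ / (toyC₃ B β₂ β₃ * β₃)))⁻¹ - 1) := by
    intro n
    rw [h.toyU_eq, ← pow_mul, div_pow, inv_neg, inv_div]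
    field_simp
    ring
  have hzeta : toyZeta B β₂ β₃ = 1 + 4 * algebraMap ℚ_[2] (PadicAlgCl 2) z := by
    rw [hz, toyZeta]; ring
  set A := -(toyC₂ B β₂ β₃ * β₂ / (toyC₃ B β₂ β₃ * β₃)) with hAdef
  set q := (β₃ / β₂) ^ 4 with hqdef
  have hA : ‖A - 1‖ < 1 / 2 := by rw [nA]; norm_num
  have hA1 : ‖A - 1‖ < 1 := by rw [nA]; norm_num
  have hq : ‖q - 1‖ < 1 / 2 := by rw [nq]; norm_num
  have hq1 : ‖q - 1‖ < 1 := by rw [nq]; norm_num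
  have hL : ‖padicLog 2 q‖ = 1 / 8 := by rw [norm_padicLog_two hq, nq]
  have hL0 : padicLog 2 q ≠ 0 := norm_pos_iff.1 (by rw [hL]; norm_num)
  have hznorm : ‖z‖ = 1 / 2 := by
    rw [← norm_algebraMap' (PadicAlgCl 2) z, hz, norm_div, hL, norm_padicLog_two hA, nA]
    norm_num
  have n4z : ‖4 * z‖ = 1 / 8 := by
    rw [← norm_algebraMap' (PadicAlgCl 2) (4 * z), map_mul, map_ofNat, _root_.norm_mul, n4,
      norm_algebraMap', hznorm]
    norm_num
  have hle : ‖1 + 4 * z‖ ≤ 1 :=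
    (IsUltrametricDist.norm_add_le_max _ _).trans (max_le (by simp) (by rw [n4z]; norm_num))
  obtain ⟨ζ, hζ⟩ : ∃ ζ : ℤ_[2], (ζ : ℚ_[2]) = 1 + 4 * z := ⟨⟨1 + 4 * z, hle⟩, rfl⟩
  refine ⟨ζ, ?_, ?_, fun n => ?_⟩
  · rw [hzeta]
    change algebraMap ℚ_[2] (PadicAlgCl 2) (ζ : ℚ_[2]) = _
    rw [hζ]
    simp only [map_add, map_mul, map_one, map_ofNat]
  · rw [← PadicInt.padic_norm_e_of_padicInt, PadicInt.coe_sub, PadicInt.coe_one, hζ,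
      add_sub_cancel_left, n4z]
  · have hAi : ‖A⁻¹ - 1‖ < 1 / 2 := by rwa [PadicAlgCl.norm_inv_sub_one hA1]
    have hqn := PadicAlgCl.norm_pow_sub_one_lt (by norm_num) hq n
    have hprod := PadicAlgCl.norm_mul_sub_one_lt (by norm_num) hqn hAi
    -- The logarithm linearizes `q^n A⁻¹`, exposing the factor `n - z`, which is `(4n + 1 - ζ)/4`.
    have elog : padicLog 2 (q ^ n * A⁻¹) =
        padicLog 2 q * algebraMap ℚ_[2] (PadicAlgCl 2) (n - z) := by
      rw [padicLog_mul (hqn.trans (by norm_num)) (hAi.trans (by norm_num)), padicLog_pow hq1,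
        padicLog_inv hA1, map_sub, map_natCast, hz]
      field_simp
      ring
    have e4 : ‖((4 * n + 1 : ℕ) : ℤ_[2]) - ζ‖ = 1 / 4 * ‖n - z‖ := by
      rw [← PadicInt.padic_norm_e_of_padicInt, PadicInt.coe_sub, PadicInt.coe_natCast, hζ,
        show ((4 * n + 1 : ℕ) : ℚ_[2]) - (1 + 4 * z) = 4 * (n - z) by push_cast; ring,
        _root_.norm_mul, ← norm_algebraMap' (PadicAlgCl 2) (4 : ℚ_[2]), map_ofNat, n4]
    have e5 : ‖β₂‖ ^ (4 * n) = (1 / 4) ^ n := by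
      rw [show 4 * n = 2 * (2 * n) by ring, pow_mul, h.norm_sq, pow_mul]; norm_num
    rw [hU, _root_.norm_mul, _root_.norm_mul, norm_neg, h.norm_coeff_mul, norm_pow, e5,
      ← norm_padicLog_two hprod, elog, _root_.norm_mul, hL, norm_algebraMap', e4]
    ring

end IsToyRoots

/-! ### Zero blocks of digits and approximation of `ζ` by integers. -/

/-- If `i < p ^ a` is congruent to `x` modulo `p ^ m`, the digits of `x` in positions `a` to `m - 1`
vanish. -/
theorem padicDigit_eq_zero_of_dvd {p : ℕ} [Fact p.Prime] {x : ℤ_[p]} {i a m j : ℕ}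
    (hi : i < p ^ a) (hdvd : (p : ℤ_[p]) ^ m ∣ x - i) (haj : a ≤ j) (hjm : j < m) :
    padicDigit x j = 0 := by
  have hp : 1 < p := (Fact.out : p.Prime).one_lt
  have h1 := PadicInt.zmod_congr_of_sub_mem_span (j + 1) x (x.appr (j + 1)) i
    (PadicInt.appr_spec _ _)
    (Ideal.mem_span_singleton.2 ((pow_dvd_pow _ (by omega)).trans hdvd))
  have hij : i < p ^ j := hi.trans_le (Nat.pow_le_pow_right hp.le haj)
  have h2 : x.appr (j + 1) = i := by
    rw [ZMod.natCast_eq_natCast_iff] at h1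
    exact h1.eq_of_lt_of_lt (PadicInt.appr_lt _ _)
      (hij.trans_le (Nat.pow_le_pow_right hp.le (by omega)))
  rw [padicDigit, h2, Nat.div_eq_of_lt hij]

theorem BlockLengthBound.lt_norm_sub {ζ : ℤ_[2]} (h : BlockLengthBound ζ) {i n : ℕ} (hn : 4 ≤ n)
    (hi : i < 2 ^ n) : (1 / 4) ^ n < ‖(i : ℤ_[2]) - ζ‖ := by
  by_contra! hle
  have hdvd : ((2 : ℕ) : ℤ_[2]) ^ (2 * n) ∣ ζ - i := by
    rw [← Ideal.mem_span_singleton, ← PadicInt.norm_le_pow_iff_mem_span_pow, norm_sub_rev]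
    refine hle.trans (le_of_eq ?_)
    rw [zpow_neg, zpow_natCast, pow_mul, ← inv_pow]
    norm_num
  obtain ⟨ℓ, hℓ, hbound⟩ := h n
  -- Positions `n` to `2n - 1` all carry the digit zero. But `n ≤ (2/95)n + 18/5` fails for `n ≥ 4`.
  have hnl : n ≤ ℓ := hℓ.2 fun j hj =>
    padicDigit_eq_zero_of_dvd hi hdvd (Nat.le_add_right n j) (by omega)
  have h1 : (n : ℝ) ≤ ℓ := by exact_mod_cast hnl
  have h2 : (4 : ℝ) ≤ n := by exact_mod_cast hn
  linarith

/-! ### The residue classes other than 1 modulo 4, and additive valuations. -/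

/-- The valuations of `U_{4n}`, `U_{4n+2}`, `U_{4n+3}` for `n ≥ 1`. -/
theorem exists_toyU_eq (n : ℕ) : ∃ a b c d : ℕ,
    toyU (4 * (n + 1)) = 2 ^ (2 * n + 1) * (2 * a + 1) ∧
      toyU (4 * (n + 1) + 1) = 2 ^ (2 * n + 2) * (2 * b) ∧
      toyU (4 * (n + 1) + 2) = 2 ^ (2 * n + 2) * (2 * c + 1) ∧
      toyU (4 * (n + 1) + 3) = 2 ^ (2 * n + 3) * (2 * d + 1) := by
  have step : ∀ {k a b c : ℕ}, toyU k = 2 ^ (2 * n + 1) * (2 * a + 1) →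
      toyU (k + 1) = 2 ^ (2 * n + 2) * (2 * b) → toyU (k + 2) = 2 ^ (2 * n + 2) * (2 * c + 1) →
      toyU (k + 3) = 2 ^ (2 * n + 3) * (2 * (3 * b + 6 * c + 3 * a + 4) + 1) := by
    intro k a b c ha hb hc
    rw [toyU, ha, hb, hc]; ring
  induction n with
  | zero =>
    refine ⟨6421, 40308, 506029, _, ?_, ?_, ?_, step (a := 6421) (b := 40308) (c := 506029) ?_ ?_ ?_⟩
    all_goals simp [toyU]
  | succ n ih =>
    -- Since `step` mentions `n`, its version for the previous index is a premise of the induction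
    -- hypothesis and is proved again.
    obtain ⟨a, b, c, d, -, hb, hc, hd⟩ := ih (by
      intro k a b c ha hb hc
      rw [toyU, ha, hb, hc]; ring)
    obtain ⟨a', ha'⟩ : ∃ a', a' = 6 * (2 * d + 1) + 3 * c + 1 + 6 * b := ⟨_, rfl⟩
    obtain ⟨b', hb'⟩ : ∃ b', b' = 3 * (2 * a' + 1 + d + c + 1) := ⟨_, rfl⟩
    obtain ⟨c', hc'⟩ : ∃ c', c' = 12 * b' + 3 * a' + 1 + 3 * (2 * d + 1) := ⟨_, rfl⟩
    have h4 : toyU (4 * (n + 1 + 1)) = 2 ^ (2 * (n + 1) + 1) * (2 * a' + 1) := by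
      rw [show 4 * (n + 1 + 1) = 4 * (n + 1) + 1 + 3 by ring, toyU, hb, hc, hd, ha']; ring
    have h5 : toyU (4 * (n + 1 + 1) + 1) = 2 ^ (2 * (n + 1) + 2) * (2 * b') := by
      rw [show 4 * (n + 1 + 1) + 1 = 4 * (n + 1) + 2 + 3 by ring, toyU, hc, hd,
        show 4 * (n + 1) + 2 + 2 = 4 * (n + 1 + 1) by ring, h4, hb']; ring
    have h6 : toyU (4 * (n + 1 + 1) + 2) = 2 ^ (2 * (n + 1) + 2) * (2 * c' + 1) := by
      rw [show 4 * (n + 1 + 1) + 2 = 4 * (n + 1) + 3 + 3 by ring, toyU, hd,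
        show 4 * (n + 1) + 3 + 2 = 4 * (n + 1 + 1) + 1 by ring,
        show 4 * (n + 1) + 3 + 1 = 4 * (n + 1 + 1) by ring, h4, h5, hc']; ring
    exact ⟨a', b', c', _, h4, h5, h6, step h4 h5 h6⟩

theorem Padic.addValuation_eq_of_norm_eq {p : ℕ} [Fact p.Prime] {x y : ℚ_[p]} (h : ‖x‖ = ‖y‖) :
    Padic.addValuation x = Padic.addValuation y := by
  by_cases hx : x = 0
  · rw [hx, norm_zero] at h
    rw [hx, norm_eq_zero.1 h.symm]
  · have hy : y ≠ 0 := by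
      rintro rfl
      rw [norm_zero] at h
      exact hx (norm_eq_zero.1 h)
    rw [Padic.addValuation.apply hx, Padic.addValuation.apply hy]
    rw [Padic.norm_eq_zpow_neg_valuation hx, Padic.norm_eq_zpow_neg_valuation hy] at h
    have hp : 1 < (p : ℝ) := by exact_mod_cast (Fact.out : p.Prime).one_lt
    rw [neg_injective (zpow_right_injective₀ (by positivity) hp.ne' h)]

theorem addValuation_two_pow_mul_odd (k m : ℕ) :
    Padic.addValuation ((2 ^ k * (2 * m + 1) : ℕ) : ℚ_[2]) = (k : WithTop ℤ) := by
  have h0 : 2 ^ k * (2 * m + 1) ≠ 0 := by positivity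
  rw [Padic.addValuation.apply (by exact_mod_cast h0), Padic.valuation_natCast,
    padicValNat.mul (by positivity) (by omega), padicValNat.prime_pow,
    padicValNat.eq_zero_of_not_dvd (by omega)]
  simp

theorem PadicInt.norm_two_pow_mul_odd (k : ℕ) (x : ℤ_[2]) :
    ‖2 ^ k * (1 + 2 * x)‖ = (1 / 2) ^ k := by
  rw [← norm_padicIntToAlgCl, ← _root_.norm_two_pow_mul_odd k x]
  simp only [map_mul, map_pow, map_add, map_one, map_ofNat]

theorem BlockLengthBound.lt_norm_four_mul_add_one_sub {ζ : ℤ_[2]} (h : BlockLengthBound ζ)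
    (hζ : ‖ζ - 1‖ = 1 / 8) {n : ℕ} (hn : 3 ≤ n) :
    (1 / 4) ^ n < ‖((4 * n + 1 : ℕ) : ℤ_[2]) - ζ‖ := by
  have small : ∀ m : ℕ, ‖((4 * m : ℕ) : ℤ_[2])‖ ≠ 1 / 8 →
      1 / 8 ≤ ‖((4 * m + 1 : ℕ) : ℤ_[2]) - ζ‖ := by
    intro m hm
    rw [show ((4 * m + 1 : ℕ) : ℤ_[2]) - ζ = ((4 * m : ℕ) : ℤ_[2]) + -(ζ - 1) by push_cast; ring,
      IsUltrametricDist.norm_add_eq_max_of_norm_ne_norm (by rwa [norm_neg, hζ]), norm_neg, hζ]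
    exact le_max_right _ _
  -- The inequality `4n + 1 < 2^n` starts at `n = 5`. For `n = 3, 4` the norms of `12` and `16`
  -- differ from `‖ζ - 1‖ = 1/8`, which already gives a distance of at least `1/8`.
  obtain rfl | rfl | hn : n = 3 ∨ n = 4 ∨ 5 ≤ n := by omega
  · refine lt_of_lt_of_le (by norm_num) (small 3 ?_)
    have := PadicInt.norm_two_pow_mul_odd 2 1
    rw [show ((4 * 3 : ℕ) : ℤ_[2]) = 2 ^ 2 * (1 + 2 * 1) by norm_num, this]
    norm_num
  · refine lt_of_lt_of_le (by norm_num) (small 4 ?_)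
    have := PadicInt.norm_two_pow_mul_odd 4 0
    rw [show ((4 * 4 : ℕ) : ℤ_[2]) = 2 ^ 4 * (1 + 2 * 0) by norm_num, this]
    norm_num
  · refine h.lt_norm_sub (by omega) ?_
    induction n, hn using Nat.le_induction with
    | base => norm_num
    | succ n hn ih => rw [pow_succ]; have := ih (by omega); omega

/-! ### The valuation formula. -/

theorem theoremp (β₁ : ℤ_[2]) (β₂ β₃ : PadicAlgCl 2) (hβ : IsToyRoots β₁ β₂ β₃) :
    ∃ ζ : ℤ_[2], padicIntToAlgCl 2 ζ = toyZeta (padicIntToAlgCl 2 β₁) β₂ β₃ ∧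
      (BlockLengthBound ζ →
        ∀ i : ℕ, 10 ≤ i →
          Padic.addValuation (toyU i : ℚ_[2]) =
            (((i - 1) / 2 : ℕ) : WithTop ℤ) +
              if i ≡ 1 [MOD 4] then Padic.addValuation ((i : ℚ_[2]) - (ζ : ℚ_[2])) else 0) := by
  obtain ⟨ζ, hζ, hζ1, hU⟩ := hβ.exists_zeta
  refine ⟨ζ, hζ, fun hblock i hi => ?_⟩
  by_cases h1 : i ≡ 1 [MOD 4]
  · rw [if_pos h1]
    obtain ⟨n, rfl⟩ : ∃ n, i = 4 * n + 1 := ⟨i / 4, by unfold Nat.ModEq at h1; omega⟩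
    have hlt := hblock.lt_norm_four_mul_add_one_sub hζ1 (n := n) (by omega)
    have hmain : ‖toyC₁ (padicIntToAlgCl 2 β₁) β₂ β₃ * padicIntToAlgCl 2 β₁ ^ (4 * n + 1)‖ =
        (1 / 4) ^ n * (1 / 4) ^ n := by
      rw [norm_mul, norm_pow, hβ.norm_toyC₁, hβ.norm_root, pow_succ, show 4 * n = 2 * (n + n) by ring,
        pow_mul, pow_add]
      norm_num
      ring
    -- After rewriting, this says that `c₁β₁^i` is strictly smaller than the rest of `U_i`, so the
    -- ultrametric inequality determines `‖U_i‖`.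
    have hlt2 := mul_lt_mul_of_pos_left hlt (by positivity : (0 : ℝ) < (1 / 4) ^ n)
    rw [← hmain, ← hU] at hlt2
    have hnorm : ‖(toyU (4 * n + 1) : ℚ_[2])‖ =
        ‖((2 ^ (2 * n) * (2 * 0 + 1) : ℕ) : ℚ_[2]) * (((4 * n + 1 : ℕ) : ℚ_[2]) - (ζ : ℚ_[2]))‖ := by
      have h2 := IsUltrametricDist.norm_add_eq_max_of_norm_ne_norm hlt2.ne'
      rw [sub_add_cancel, max_eq_left hlt2.le, hU] at h2
      have hp := Padic.norm_p (p := 2)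
      push_cast at hp
      rw [← norm_natCast_eq_padicNorm 2 (PadicAlgCl 2), h2, norm_mul,
        ← PadicInt.padic_norm_e_of_padicInt, PadicInt.coe_sub, PadicInt.coe_natCast]
      congr 1
      push_cast [mul_zero, zero_add]
      rw [mul_one, norm_pow, hp, pow_mul]
      norm_num
    rw [Padic.addValuation_eq_of_norm_eq hnorm, AddValuation.map_mul, addValuation_two_pow_mul_odd,
      show (4 * n + 1 - 1) / 2 = 2 * n by omega]
  · rw [if_neg h1, add_zero]
    obtain ⟨n, r, rfl, hr⟩ : ∃ n r, i = 4 * (n + 1) + r ∧ (r = 0 ∨ r = 2 ∨ r = 3) :=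
      ⟨i / 4 - 1, i % 4, by omega, by unfold Nat.ModEq at h1; omega⟩
    obtain ⟨a, b, c, d, ha, -, hc, hd⟩ := exists_toyU_eq n
    rcases hr with rfl | rfl | rfl
    · rw [add_zero, ha, addValuation_two_pow_mul_odd,
        show (4 * (n + 1) - 1) / 2 = 2 * n + 1 by omega]
    · rw [hc, addValuation_two_pow_mul_odd, show (4 * (n + 1) + 2 - 1) / 2 = 2 * n + 2 by omega]
    · rw [hd, addValuation_two_pow_mul_odd, show (4 * (n + 1) + 3 - 1) / 2 = 2 * n + 3 by omega]
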